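/- Let $n\ge 4$ be an integer and let $\|\cdot\|$ be any norm on $\mathbb{R}^n$. For $\boldsymbol\xi\in\mathbb{R}^n$ and $t\ge 1$ put \[ \psi_{\boldsymbol\xi}(\|\cdot\|,t)=\min\left\{\,|b_1\xi_1+\dots+b_n\xi_n+b_{n+1}| \;:\; (b_1,\dots,b_{n+1})\in\mathbb{Z}^{n+1},\ 1\le\|(b_1,\dots,b_n)\|\le t\,\right\} \] (which is defined for all large $t$), and let \[ \Theta(\|\cdot\|,\boldsymbol\xi)=\limsup_{t\to\infty} t^n\,\psi_{\boldsymbol\xi}(\|\cdot\|,t),\qquad \widetilde\Theta(\|\cdot\|,\boldsymbol\xi)=\liminf_{t\to\infty} t^n\,\psi_{\boldsymbol\xi}(\|\cdot\|,t). \] Let $Bad_n=\{\boldsymbol\xi\in\mathbb{R}^n : \widetilde\Theta(\|\cdot\|_\infty,\boldsymbol\xi)>0\}$, where $\|\cdot\|_\infty$ is the maximum norm, and for real $c\ge 0$ let \[ FS_n(\|\cdot\|,c)=\{\boldsymbol\xi\in\mathbb{R}^n : \Theta(\|\cdot\|,\boldsymbol\xi)=c\}\setminus Bad_n . \] Then there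 is $c_n=c_n(\|\cdot\|)>0$ such that for every $c\in[0,c_n]$ the Hausdorff dimension satisfies \[ \dim_H FS_n(\|\cdot\|,c)\ge n-2 . \] In particular, the dual Dirichlet spectrum $\{\Theta(\|\cdot\|,\boldsymbol\xi):\boldsymbol\xi\in\mathbb{R}^n\}$ contains a right neighbourhood of $0$, that is, an interval $[0,\varepsilon)$ for some $\varepsilon>0$. -/

import Mathlib

open scoped Topology ENNReal

namespace DualDirichlet

/-- For a norm `N` on `ℝⁿ`, a vector `ξ` and a parameter `t`: the minimum of
`|b₁ ξ₁ + ⋯ + bₙ ξₙ + b'|` over integers `b₁, …, bₙ, b'` with `1 ≤ N (b₁, …, bₙ) ≤ t`.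
The set is nonempty for all large `t`, and then the infimum is attained (there are finitely
many `b`, and for each of them a nearest integer). -/
noncomputable def psi {n : ℕ} (N : Seminorm ℝ (Fin n → ℝ)) (ξ : Fin n → ℝ) (t : ℝ) : ℝ :=
  sInf {y : ℝ | ∃ (b : Fin n → ℤ) (b' : ℤ),
    1 ≤ N (fun i => (b i : ℝ)) ∧ N (fun i => (b i : ℝ)) ≤ t ∧
      y = |(∑ i, (b i : ℝ) * ξ i) + (b' : ℝ)|}

/-- The Dirichlet constant `limsup_{t → ∞} tⁿ ψ(t)`. It is taken in the extended reals, so that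
no boundedness is presupposed. -/
noncomputable def Theta {n : ℕ} (N : Seminorm ℝ (Fin n → ℝ)) (ξ : Fin n → ℝ) : EReal :=
  Filter.limsup (fun t : ℝ => ((t ^ n * psi N ξ t : ℝ) : EReal)) Filter.atTop

/-- The asymptotic constant `liminf_{t → ∞} tⁿ ψ(t)`. -/
noncomputable def ThetaTilde {n : ℕ} (N : Seminorm ℝ (Fin n → ℝ)) (ξ : Fin n → ℝ) : EReal :=
  Filter.liminf (fun t : ℝ => ((t ^ n * psi N ξ t : ℝ) : EReal)) Filter.atTop

/-- Vectors whose Dirichlet constant is exactly `c`. -/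
def DI {n : ℕ} (N : Seminorm ℝ (Fin n → ℝ)) (c : ℝ) : Set (Fin n → ℝ) :=
  {ξ | Theta N ξ = (c : EReal)}

/-- Badly approximable vectors (dual setting), with respect to the maximum norm, which is
the norm of the type `Fin n → ℝ`. -/
def Bad (n : ℕ) : Set (Fin n → ℝ) :=
  {ξ | 0 < ThetaTilde (normSeminorm ℝ (Fin n → ℝ)) ξ}

/-- The refined Folklore set: Dirichlet constant exactly `c`, and not badly approximable. -/
def FS {n : ℕ} (N : Seminorm ℝ (Fin n → ℝ)) (c : ℝ) : Set (Fin n → ℝ) :=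
  DI N c \ Bad n

/-- The dual Dirichlet spectrum: all real values of the Dirichlet constant. -/
def dirichletSpectrum {n : ℕ} (N : Seminorm ℝ (Fin n → ℝ)) : Set ℝ :=
  {c | ∃ ξ : Fin n → ℝ, Theta N ξ = (c : EReal)}

end DualDirichlet

/-!
The vectors are built as `(x, y, η)` with `(x, y)` one special point of the plane and `η` ranging
over a set of positive measure in the unit cube of dimension `n - 2`.

*The plane* (`exists_planar_point`). In two variables the minima of integral linear forms can decay
much faster than the Dirichlet rate, and here they are prescribed. Rational lines `b k` of heights
`X k` and rational points `p k` on them are chosen in turn: the line `b (k + 1)` passes through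
`p k` and forms with `b k` a basis of the lattice of integral lines through `p k`, its height being
huge; the point `p (k + 1)` lies on it, close to `p k`, at a distance tuned so that the value of
`b k` at `p (k + 1)` is slightly larger than `c / X (k + 1) ^ n`. By the basis property every line
through `p k` of height less than `X (k + 1)` has at `p (k + 1)` at least the value of `b k`, and
the lines avoiding `p k` have much larger values (`RatFlag.exists_step`). Since `n ≥ 3`, a large
height leaves room for this. The inequalities are open, so they pass to the limit point of a nested
sequence of balls.

*The generic coordinates.* There are `O(X ^ n)` integral forms of height less than `X`, and a form
that involves `η` is within `c / X ^ n` of an integer on a set of measure at most `2 c / X ^ n`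
(`volume_near_integer_le`). Hence for `c` small, the forms involving `η` interfere at stage `k`
only for `η` in a set of measure at most `1 / 2`, and the set of `η` for which they do not interfere
at infinitely many stages has positive measure (`le_dimH_frequently_notMem`).

For such `η`, the forms `b k` give `Theta ≤ c` (`Theta_le`), the good stages give `c ≤ Theta`
(`le_Theta`), and `X (k + 1) / X k → ∞` makes the vector not badly approximable (`notMem_Bad`).
-/

namespace DualDirichlet

open MeasureTheory Filter

/-! ### A point of the plane with prescribed minima -/


/-- A rational point `(p₁, p₂)` of the plane on the rational line `b₁ x + b₂ y + b₃ = 0`, the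
equation of the line being primitive. Primitivity is stated as: every integer vector parallel to
`(b₁, b₂, b₃)` is an integer multiple of it. -/
structure RatFlag where
  b₁ : ℤ
  b₂ : ℤ
  b₃ : ℤ
  p₁ : ℚ
  p₂ : ℚ
  ne_zero : b₁ ≠ 0 ∨ b₂ ≠ 0
  mem_line : (b₁ : ℚ) * p₁ + b₂ * p₂ + b₃ = 0
  primitive : ∀ a₁ a₂ a₃ : ℤ, a₁ * b₂ = a₂ * b₁ → a₁ * b₃ = a₃ * b₁ → a₂ * b₃ = a₃ * b₂ →
    ∃ x : ℤ, a₁ = x * b₁ ∧ a₂ = x * b₂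

/-- The value of the seminorm `M` at the linear part of the equation of the line. -/
noncomputable def RatFlag.height (F : RatFlag) (M : Seminorm ℝ (ℝ × ℝ)) : ℝ := M (F.b₁, F.b₂)

/-- The point of the flag as a point of the real plane. -/
def RatFlag.pt (F : RatFlag) : ℝ × ℝ := (F.p₁, F.p₂)

/-- The equation of the line of a flag extends to a basis of the lattice of all integral equations
of lines through its point. -/
theorem RatFlag.exists_basis (F : RatFlag) : ∃ g d₁ d₂ d₃ : ℤ, 0 < g ∧
    (d₁ : ℚ) * F.p₁ + d₂ * F.p₂ + d₃ = 0 ∧ F.b₁ * d₂ - F.b₂ * d₁ = g ∧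
    ∀ a₁ a₂ a₃ : ℤ, (a₁ : ℚ) * F.p₁ + a₂ * F.p₂ + a₃ = 0 →
      ∃ x y : ℤ, a₁ = x * F.b₁ + y * d₁ ∧ a₂ = x * F.b₂ + y * d₂ := by
  classical
  obtain ⟨b₁, b₂, b₃, p₁, p₂, h0, hl, hp⟩ := F
  simp only
  have hex : ∃ g : ℕ, 0 < g ∧ ∃ d₁ d₂ d₃ : ℤ, (d₁ : ℚ) * p₁ + d₂ * p₂ + d₃ = 0 ∧
      b₁ * d₂ - b₂ * d₁ = g := by
    have hb : 0 < b₁ * b₁ + b₂ * b₂ := by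
      rcases h0 with h | h
      · have := mul_self_pos.2 h
        nlinarith [mul_self_nonneg b₂]
      · have := mul_self_pos.2 h
        nlinarith [mul_self_nonneg b₁]
    have hq : (0 : ℤ) < p₁.den * p₂.den := by
      have := p₁.den_pos
      have := p₂.den_pos
      positivity
    have hq1 : p₁ * p₁.den = p₁.num := Rat.mul_den_eq_num p₁
    have hq2 : p₂ * p₂.den = p₂.num := Rat.mul_den_eq_num p₂
    refine ⟨((p₁.den * p₂.den) * (b₁ * b₁ + b₂ * b₂)).toNat, ?_, -(p₁.den * p₂.den * b₂),
      p₁.den * p₂.den * b₁, p₁.num * p₂.den * b₂ - p₁.den * p₂.num * b₁, ?_, ?_⟩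
    · have := mul_pos hq hb
      omega
    · push_cast
      rw [← hq1, ← hq2]
      ring
    · rw [Int.toNat_of_nonneg (mul_pos hq hb).le]
      ring
  obtain ⟨hg, d₁, d₂, d₃, hd, hdet⟩ := Nat.find_spec hex
  have hmin := fun m => @Nat.find_min _ _ hex m
  set g := Nat.find hex
  refine ⟨g, d₁, d₂, d₃, by exact_mod_cast hg, hd, hdet, fun a₁ a₂ a₃ ha => ?_⟩
  have hgz : (0 : ℤ) < g := by exact_mod_cast hg
  obtain ⟨y, r, hr0, hrg, hyr⟩ : ∃ y r : ℤ, 0 ≤ r ∧ r < g ∧ b₁ * a₂ - b₂ * a₁ = g * y + r :=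
    ⟨(b₁ * a₂ - b₂ * a₁) / g, (b₁ * a₂ - b₂ * a₁) % g, Int.emod_nonneg _ hgz.ne',
      Int.emod_lt_of_pos _ hgz, (Int.mul_ediv_add_emod _ _).symm⟩
  have he : ((a₁ - y * d₁ : ℤ) : ℚ) * p₁ + (a₂ - y * d₂ : ℤ) * p₂ + (a₃ - y * d₃ : ℤ) = 0 := by
    push_cast
    linear_combination ha - y * hd
  have hdet' : b₁ * (a₂ - y * d₂) - b₂ * (a₁ - y * d₁) = r := by
    linear_combination hyr - y * hdet
  -- The remainder vanishes because `g` is the least positive determinant.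
  have hr : r = 0 := by
    by_contra hne
    refine hmin r.toNat (by omega) ⟨by omega, _, _, _, he, ?_⟩
    rw [Int.toNat_of_nonneg hr0]
    exact hdet'
  rw [hr] at hdet'
  obtain ⟨x, hx₁, hx₂⟩ := hp (a₁ - y * d₁) (a₂ - y * d₂) (a₃ - y * d₃)
    (by linear_combination -hdet')
    (by
      have hq : b₁ * ((a₂ : ℚ) - y * d₂) - b₂ * (a₁ - y * d₁) = 0 := by exact_mod_cast hdet'
      have : ((a₁ : ℚ) - y * d₁) * b₃ = (a₃ - y * d₃) * b₁ := by
        push_cast at he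
        linear_combination (a₁ - y * d₁ : ℚ) * hl - (b₁ : ℚ) * he + p₂ * hq
      exact_mod_cast this)
    (by
      have hq : b₁ * ((a₂ : ℚ) - y * d₂) - b₂ * (a₁ - y * d₁) = 0 := by exact_mod_cast hdet'
      have : ((a₂ : ℚ) - y * d₂) * b₃ = (a₃ - y * d₃) * b₂ := by
        push_cast at he
        linear_combination (a₂ - y * d₂ : ℚ) * hl - (b₂ : ℚ) * he - p₁ * hq
      exact_mod_cast this)
  exact ⟨x, y, by linarith, by linarith⟩

section Step

variable {M : Seminorm ℝ (ℝ × ℝ)} {C : ℝ}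

theorem RatFlag.height_pos (F : RatFlag) (hC : ∀ x, ‖x‖ ≤ C * M x) : 0 < F.height M := by
  refine lt_of_le_of_ne (apply_nonneg _ _) fun h => ?_
  have h1 := hC (F.b₁, F.b₂)
  rw [show M (F.b₁, F.b₂) = 0 from h.symm, mul_zero, norm_le_zero_iff, Prod.mk_eq_zero] at h1
  rcases F.ne_zero with h2 | h2
  · exact h2 (by exact_mod_cast h1.1)
  · exact h2 (by exact_mod_cast h1.2)

/-- As `RatFlag.exists_basis`, the second basis vector having large seminorm: multiples of the
first one may be added to it. -/
theorem RatFlag.exists_basis_gt (F : RatFlag) (hC : ∀ x, ‖x‖ ≤ C * M x) (R : ℝ) :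
    ∃ g d₁ d₂ d₃ : ℤ, 0 < g ∧ R < M (d₁, d₂) ∧
    (d₁ : ℚ) * F.p₁ + d₂ * F.p₂ + d₃ = 0 ∧ F.b₁ * d₂ - F.b₂ * d₁ = g ∧
    ∀ a₁ a₂ a₃ : ℤ, (a₁ : ℚ) * F.p₁ + a₂ * F.p₂ + a₃ = 0 →
      ∃ x y : ℤ, a₁ = x * F.b₁ + y * d₁ ∧ a₂ = x * F.b₂ + y * d₂ := by
  obtain ⟨g, d₁, d₂, d₃, hg, hd, hdet, hbas⟩ := F.exists_basis
  obtain ⟨k, hk⟩ := exists_nat_gt ((R + M (d₁, d₂)) / F.height M)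
  rw [div_lt_iff₀ (F.height_pos hC)] at hk
  refine ⟨g, d₁ + k * F.b₁, d₂ + k * F.b₂, d₃ + k * F.b₃, hg, ?_, ?_, ?_, fun a₁ a₂ a₃ ha => ?_⟩
  · have h1 : M ((k : ℝ) • ((F.b₁ : ℝ), (F.b₂ : ℝ))) = k * F.height M := by
      rw [map_smul_eq_mul, Real.norm_natCast]; rfl
    have h2 : (k : ℝ) • ((F.b₁ : ℝ), (F.b₂ : ℝ)) =
        (((d₁ + k * F.b₁ : ℤ) : ℝ), ((d₂ + k * F.b₂ : ℤ) : ℝ)) - ((d₁ : ℝ), (d₂ : ℝ)) := by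
      ext <;> simp
    have h3 := map_sub_le_add M (((d₁ + k * F.b₁ : ℤ) : ℝ), ((d₂ + k * F.b₂ : ℤ) : ℝ))
      ((d₁ : ℝ), (d₂ : ℝ))
    rw [← h2, h1] at h3
    linarith
  · push_cast
    linear_combination hd + k * F.mem_line
  · linear_combination hdet
  · obtain ⟨x, y, h1, h2⟩ := hbas a₁ a₂ a₃ ha
    exact ⟨x - y * k, y, by linear_combination h1, by linear_combination h2⟩

/-- A value of an integral linear form at a rational point is zero or bounded away from zero. -/
theorem RatFlag.exists_le_abs (F : RatFlag) : ∃ q : ℝ, 0 < q ∧ ∀ a₁ a₂ a₃ : ℤ,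
    (a₁ : ℚ) * F.p₁ + a₂ * F.p₂ + a₃ ≠ 0 →
      q⁻¹ ≤ |(a₁ : ℝ) * F.p₁ + a₂ * F.p₂ + a₃| := by
  have hq : (0 : ℝ) < F.p₁.den * F.p₂.den := by
    have := F.p₁.den_pos
    have := F.p₂.den_pos
    positivity
  refine ⟨F.p₁.den * F.p₂.den, hq, fun a₁ a₂ a₃ h => ?_⟩
  have hq1 : F.p₁ * F.p₁.den = F.p₁.num := Rat.mul_den_eq_num _
  have hq2 : F.p₂ * F.p₂.den = F.p₂.num := Rat.mul_den_eq_num _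
  have hz : ((a₁ : ℚ) * F.p₁ + a₂ * F.p₂ + a₃) * (F.p₁.den * F.p₂.den) =
      (a₁ * F.p₁.num * F.p₂.den + a₂ * F.p₂.num * F.p₁.den + a₃ * (F.p₁.den * F.p₂.den) : ℤ) := by
    push_cast
    rw [← hq1, ← hq2]
    ring
  have hzR : ((a₁ : ℝ) * F.p₁ + a₂ * F.p₂ + a₃) * (F.p₁.den * F.p₂.den) =
      (a₁ * F.p₁.num * F.p₂.den + a₂ * F.p₂.num * F.p₁.den + a₃ * (F.p₁.den * F.p₂.den) : ℤ) := by
    exact_mod_cast congrArg (Rat.cast : ℚ → ℝ) hz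
  rw [inv_le_iff_one_le_mul₀ hq]
  have hne : (a₁ * F.p₁.num * F.p₂.den + a₂ * F.p₂.num * F.p₁.den +
      a₃ * (F.p₁.den * F.p₂.den) : ℤ) ≠ 0 := by
    intro h0
    rw [h0, Int.cast_zero, mul_eq_zero] at hz
    rcases hz with hz | hz
    · exact h hz
    · exact hq.ne' (by exact_mod_cast hz)
  have h1 := Int.one_le_abs hne
  have h2 : (1 : ℝ) ≤ |((a₁ * F.p₁.num * F.p₂.den + a₂ * F.p₂.num * F.p₁.den +
      a₃ * (F.p₁.den * F.p₂.den) : ℤ) : ℝ)| := by exact_mod_cast h1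
  rw [← hzR, abs_mul, abs_of_pos hq] at h2
  exact h2

/-- One step of the construction. The new line `d` passes through the old point `p` and forms with
the old line `b` a basis of the integral lines through `p`; the new point is `p + s (-d₂, d₁)`.
There the value of `b` is `s` times the determinant `g` of `b` and `d`, and any other integral line
through `p`, save the multiples of `d`, has a value that is a nonzero multiple of `s g`. The lines
that avoid `p` have much larger values, since the height of `d` is large in terms of the
denominator of `p`. -/
theorem RatFlag.exists_step (F : RatFlag) (hC0 : 0 < C) (hC : ∀ x, ‖x‖ ≤ C * M x) {n : ℕ}
    (hn : 3 ≤ n) {c : ℝ} (hc : 0 ≤ c) (T : ℝ) {δ ε : ℝ} (hδ : 0 < δ) (hε : 0 < ε) :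
    ∃ F' : RatFlag, T < F'.height M ∧ 1 ≤ F'.height M ∧ dist F'.pt F.pt ≤ δ ∧
      |(F.b₁ : ℝ) * F'.pt.1 + F.b₂ * F'.pt.2 + F.b₃| < (c + ε) / F'.height M ^ n ∧
      ∃ κ : ℝ, c / F'.height M ^ n < κ ∧ ∀ a₁ a₂ a₃ : ℤ, (a₁ ≠ 0 ∨ a₂ ≠ 0) →
        M (a₁, a₂) < F'.height M → κ ≤ |(a₁ : ℝ) * F'.pt.1 + a₂ * F'.pt.2 + a₃| := by
  obtain ⟨q, hq, hqa⟩ := F.exists_le_abs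
  obtain ⟨g, d₁, d₂, d₃, hg, hX, hd, hdet, hbas⟩ := F.exists_basis_gt hC
    (max (max T 1) (max (q * ((c + 1) * (2 * C ^ 2 + 1))) ((c + 1) * C / δ)))
  simp only [max_lt_iff] at hX
  obtain ⟨⟨hXT, hX1⟩, hXq, hXδ⟩ := hX
  set X : ℝ := M (d₁, d₂) with hXdef
  have hX0 : 0 < X := by linarith
  have hgR : (1 : ℝ) ≤ g := by exact_mod_cast hg
  have hg0 : (0 : ℝ) < g := by linarith
  have hXn : 0 < X ^ n := by positivity
  obtain ⟨s, hs1, hs2⟩ := exists_rat_btwn (show c / (X ^ n * g) < (c + min ε 1) / (X ^ n * g) by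
    have : 0 < min ε 1 := by positivity
    gcongr
    linarith)
  have hs0 : (0 : ℝ) < s := lt_of_le_of_lt (by positivity) hs1
  have hsg1 : c / X ^ n < s * g := by
    rw [div_lt_iff₀ (by positivity)] at hs1 ⊢
    linarith
  have hsg2 : s * g * X ^ n < c + min ε 1 := by
    rw [lt_div_iff₀ (by positivity)] at hs2
    linarith
  have hsg3 : s * g * X ^ n < c + 1 := hsg2.trans_le (by gcongr; exact min_le_right _ _)
  have hXn3 : X ^ 3 ≤ X ^ n := pow_le_pow_right₀ hX1.le hn
  have hs3 : s * X ^ 3 ≤ c + 1 := by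
    have h1 : (s : ℝ) * X ^ 3 ≤ s * g * X ^ n := by
      refine mul_le_mul (le_mul_of_one_le_right hs0.le hgR) hXn3 (by positivity) (by positivity)
    linarith
  have hsg4 : s * g * X ≤ c + 1 := by
    have h1 : (s : ℝ) * g * X ≤ s * g * X ^ n := by
      gcongr
      exact le_self_pow₀ hX1.le (by omega)
    linarith
  have hd1 : |(d₁ : ℝ)| ≤ C * X := (norm_fst_le ((d₁ : ℝ), (d₂ : ℝ))).trans (hC _)
  have hd2 : |(d₂ : ℝ)| ≤ C * X := (norm_snd_le ((d₁ : ℝ), (d₂ : ℝ))).trans (hC _)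
  have hclose : ∀ x : ℝ, |x| ≤ C * X → |s * x| ≤ δ := by
    intro x hx
    rw [abs_mul, abs_of_pos hs0]
    rw [div_lt_iff₀ hδ] at hXδ
    have h1 : s * |x| ≤ s * (C * X) := by gcongr
    have h2 : s * (C * X) * X ≤ δ * X := by
      have : s * (C * X) * X ≤ C * (s * X ^ 3) := by
        have : X ^ 2 ≤ X ^ 3 := pow_le_pow_right₀ hX1.le (by norm_num)
        calc s * (C * X) * X = C * (s * X ^ 2) := by ring
          _ ≤ _ := by gcongr
      nlinarith
    exact h1.trans (le_of_mul_le_mul_right h2 hX0)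
  have hd0 : d₁ ≠ 0 ∨ d₂ ≠ 0 := by
    by_contra! h
    rw [h.1, h.2] at hdet
    simp at hdet
    omega
  let F' : RatFlag :=
    { b₁ := d₁, b₂ := d₂, b₃ := d₃, p₁ := F.p₁ - s * d₂, p₂ := F.p₂ + s * d₁
      ne_zero := hd0
      mem_line := by linear_combination hd
      primitive := by
        intro a₁ a₂ a₃ h1 h2 h3
        have h1' : (a₁ : ℚ) * d₂ = a₂ * d₁ := by exact_mod_cast h1
        have h2' : (a₁ : ℚ) * d₃ = a₃ * d₁ := by exact_mod_cast h2
        have h3' : (a₂ : ℚ) * d₃ = a₃ * d₂ := by exact_mod_cast h3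
        have ha : (a₁ : ℚ) * F.p₁ + a₂ * F.p₂ + a₃ = 0 := by
          rcases hd0 with h | h
          · have h' : (d₁ : ℚ) ≠ 0 := by exact_mod_cast h
            refine (mul_eq_zero.1 (?_ : (d₁ : ℚ) * _ = 0)).resolve_left h'
            linear_combination (a₁ : ℚ) * hd - F.p₂ * h1' - h2'
          · have h' : (d₂ : ℚ) ≠ 0 := by exact_mod_cast h
            refine (mul_eq_zero.1 (?_ : (d₂ : ℚ) * _ = 0)).resolve_left h'
            linear_combination (a₂ : ℚ) * hd + F.p₁ * h1' - h3'
        obtain ⟨x, y, hx1, hx2⟩ := hbas a₁ a₂ a₃ ha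
        have hx : x * g = 0 := by
          rw [hx1, hx2] at h1
          linear_combination h1 - x * hdet
        have hx0 : x = 0 := (mul_eq_zero.1 hx).resolve_right hg.ne'
        exact ⟨y, by simpa [hx0] using hx1, by simpa [hx0] using hx2⟩ }
  have hp1 : F'.pt.1 = F.p₁ - s * d₂ := by simp [RatFlag.pt, F']
  have hp2 : F'.pt.2 = F.p₂ + s * d₁ := by simp [RatFlag.pt, F']
  have hdetR : (F.b₁ : ℝ) * d₂ - F.b₂ * d₁ = g := by exact_mod_cast hdet
  refine ⟨F', hXT, hX1.le, ?_, ?_, s * g, hsg1, fun a₁ a₂ a₃ ha hlt => ?_⟩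
  · rw [Prod.dist_eq, Real.dist_eq, Real.dist_eq, hp1, hp2]
    refine max_le ?_ ?_
    · have := hclose d₂ hd2
      simpa [RatFlag.pt] using this
    · have := hclose d₁ hd1
      simpa [RatFlag.pt] using this
  · have hl : (F.b₁ : ℝ) * F.p₁ + F.b₂ * F.p₂ + F.b₃ = 0 := by
      exact_mod_cast congrArg (Rat.cast : ℚ → ℝ) F.mem_line
    rw [hp1, hp2, show (F.b₁ : ℝ) * (F.p₁ - s * d₂) + F.b₂ * (F.p₂ + s * d₁) + F.b₃ = -(s * g) by
      linear_combination hl - s * hdetR, abs_neg, abs_of_pos (by positivity)]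
    refine (lt_div_iff₀ hXn).2 ?_
    refine hsg2.trans_le ?_
    gcongr
    exact min_le_left _ _
  · rw [hp1, hp2]
    by_cases h0 : (a₁ : ℚ) * F.p₁ + a₂ * F.p₂ + a₃ = 0
    · obtain ⟨x, y, h1, h2⟩ := hbas _ _ _ h0
      have hx : x ≠ 0 := by
        rintro rfl
        have hy : y ≠ 0 := by
          rintro rfl
          simp at h1 h2
          omega
        have hM : M (a₁, a₂) = |(y : ℝ)| * X := by
          rw [hXdef, ← Real.norm_eq_abs, ← map_smul_eq_mul, h1, h2]
          simp
        have hy1 : (1 : ℝ) ≤ |(y : ℝ)| := by exact_mod_cast Int.one_le_abs hy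
        have : M (a₁, a₂) < X := hlt
        nlinarith
      have h0R : (a₁ : ℝ) * F.p₁ + a₂ * F.p₂ + a₃ = 0 := by
        exact_mod_cast congrArg (Rat.cast : ℚ → ℝ) h0
      have h1R : (a₁ : ℝ) = x * F.b₁ + y * d₁ := by exact_mod_cast h1
      have h2R : (a₂ : ℝ) = x * F.b₂ + y * d₂ := by exact_mod_cast h2
      have hxR : (1 : ℝ) ≤ |(x : ℝ)| := by exact_mod_cast Int.one_le_abs hx
      rw [show (a₁ : ℝ) * (F.p₁ - s * d₂) + a₂ * (F.p₂ + s * d₁) + a₃ = -(x * (s * g)) by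
        rw [← hdetR]
        linear_combination h0R - s * d₂ * h1R + s * d₁ * h2R, abs_neg, abs_mul,
        abs_of_pos (show 0 < s * (g : ℝ) by positivity)]
      exact le_mul_of_one_le_left (by positivity) hxR
    · have h1 := hqa _ _ _ h0
      have hlt' : M (a₁, a₂) < X := hlt
      have ha1 : |(a₁ : ℝ)| ≤ C * X := (norm_fst_le ((a₁ : ℝ), (a₂ : ℝ))).trans ((hC _).trans
        (by gcongr))
      have ha2 : |(a₂ : ℝ)| ≤ C * X := (norm_snd_le ((a₁ : ℝ), (a₂ : ℝ))).trans ((hC _).trans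
        (by gcongr))
      have h2 : |s * ((a₂ : ℝ) * d₁ - a₁ * d₂)| ≤ s * (2 * (C * X) ^ 2) := by
        rw [abs_mul, abs_of_pos hs0]
        gcongr
        calc |(a₂ : ℝ) * d₁ - a₁ * d₂| ≤ |(a₂ : ℝ) * d₁| + |(a₁ : ℝ) * d₂| := abs_sub _ _
          _ ≤ (C * X) * (C * X) + (C * X) * (C * X) := by
            rw [abs_mul, abs_mul]
            gcongr
          _ = _ := by ring
      have h3 : |(a₁ : ℝ) * F.p₁ + a₂ * F.p₂ + a₃| ≤
          |(a₁ : ℝ) * (F.p₁ - s * d₂) + a₂ * (F.p₂ + s * d₁) + a₃| +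
            |s * ((a₂ : ℝ) * d₁ - a₁ * d₂)| := by
        refine le_trans (le_of_eq ?_) (abs_sub _ _)
        congr 1
        ring
      have h4 : s * g + s * (2 * (C * X) ^ 2) ≤ q⁻¹ := by
        refine le_of_mul_le_mul_right (?_ : _ * X ≤ _ * X) hX0
        have h5 : (c + 1) * (2 * C ^ 2 + 1) ≤ q⁻¹ * X := by
          rw [inv_mul_eq_div, le_div_iff₀ hq]
          linarith
        have h6 : (s * g + s * (2 * (C * X) ^ 2)) * X = s * g * X + 2 * C ^ 2 * (s * X ^ 3) := by
          ring
        rw [h6]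
        have h7 : 2 * C ^ 2 * (s * X ^ 3) ≤ 2 * C ^ 2 * (c + 1) := by gcongr
        linarith
      linarith

/-- The inequalities of `RatFlag.exists_step` persist on a small closed ball around the new
point. -/
theorem RatFlag.exists_step_closedBall (F : RatFlag) (hC0 : 0 < C) (hC : ∀ x, ‖x‖ ≤ C * M x) {n : ℕ}
    (hn : 3 ≤ n) {c : ℝ} (hc : 0 ≤ c) (T : ℝ) {δ ε : ℝ} (hδ : 0 < δ) (hε : 0 < ε) :
    ∃ (F' : RatFlag) (δ' : ℝ), 0 < δ' ∧ T < F'.height M ∧ 1 ≤ F'.height M ∧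
      Metric.closedBall F'.pt δ' ⊆ Metric.closedBall F.pt δ ∧
      ∀ ξ ∈ Metric.closedBall F'.pt δ',
        |(F.b₁ : ℝ) * ξ.1 + F.b₂ * ξ.2 + F.b₃| < (c + ε) / F'.height M ^ n ∧
        ∀ a₁ a₂ a₃ : ℤ, (a₁ ≠ 0 ∨ a₂ ≠ 0) → M (a₁, a₂) < F'.height M →
          c / F'.height M ^ n < |(a₁ : ℝ) * ξ.1 + a₂ * ξ.2 + a₃| := by
  obtain ⟨F', hT, h1, hdist, hup, κ, hκ, hlow⟩ :=
    F.exists_step hC0 hC hn hc T (half_pos hδ) hε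
  have hcont : Continuous fun ξ : ℝ × ℝ => |(F.b₁ : ℝ) * ξ.1 + F.b₂ * ξ.2 + F.b₃| := by fun_prop
  obtain ⟨r, hr, hrsub⟩ := Metric.nhds_basis_closedBall.mem_iff.1
    (hcont.continuousAt.eventually_lt continuousAt_const hup)
  set X := F'.height M with hX
  have hX0 : 0 < X := by linarith
  set ρ : ℝ := (κ - c / X ^ n) / (4 * (C * X)) with hρdef
  have hρ : 0 < ρ := div_pos (by linarith) (by positivity)
  refine ⟨F', min (δ / 2) (min r ρ), by positivity, hT, h1, ?_, fun ξ hξ => ⟨?_, ?_⟩⟩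
  · refine Metric.closedBall_subset_closedBall' ?_
    have := min_le_left (δ / 2) (min r ρ)
    linarith
  · exact hrsub (Metric.closedBall_subset_closedBall
      ((min_le_right _ _).trans (min_le_left _ _)) hξ)
  · intro a₁ a₂ a₃ ha hlt
    have hξρ : dist ξ F'.pt ≤ ρ := (Metric.mem_closedBall.1 hξ).trans
      ((min_le_right _ _).trans (min_le_right _ _))
    rw [Prod.dist_eq, max_le_iff, Real.dist_eq, Real.dist_eq] at hξρ
    have ha1 : |(a₁ : ℝ)| ≤ C * X := (norm_fst_le ((a₁ : ℝ), (a₂ : ℝ))).trans ((hC _).trans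
      (by gcongr))
    have ha2 : |(a₂ : ℝ)| ≤ C * X := (norm_snd_le ((a₁ : ℝ), (a₂ : ℝ))).trans ((hC _).trans
      (by gcongr))
    have h2 : |(a₁ : ℝ) * (ξ.1 - F'.pt.1) + a₂ * (ξ.2 - F'.pt.2)| ≤ (C * X) * ρ + (C * X) * ρ := by
      refine (abs_add_le _ _).trans ?_
      rw [abs_mul, abs_mul]
      gcongr
      · exact hξρ.1
      · exact hξρ.2
    have h3 : (C * X) * ρ + (C * X) * ρ = (κ - c / X ^ n) / 2 := by
      rw [hρdef]
      field_simp
      ring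
    have h4 := hlow a₁ a₂ a₃ ha hlt
    have h5 : |(a₁ : ℝ) * F'.pt.1 + a₂ * F'.pt.2 + a₃| ≤ |(a₁ : ℝ) * ξ.1 + a₂ * ξ.2 + a₃| +
        |(a₁ : ℝ) * (ξ.1 - F'.pt.1) + a₂ * (ξ.2 - F'.pt.2)| := by
      refine le_trans (le_of_eq ?_) (abs_sub _ _)
      congr 1
      ring
    linarith

/-- A point of the plane for which the successive minimal values of integral linear forms are
prescribed: they are attained by lines of rapidly growing heights `X k`, and the minimum over
integral lines of height less than `X (k + 1)` lies between `c / X (k + 1) ^ n` and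
`(c + 1 / (k + 1)) / X (k + 1) ^ n`. -/
theorem exists_planar_point (hC0 : 0 < C) (hC : ∀ x, ‖x‖ ≤ C * M x) {n : ℕ}
    (hn : 3 ≤ n) {c : ℝ} (hc : 0 ≤ c) :
    ∃ (ξ : ℝ × ℝ) (F : ℕ → RatFlag), ∀ k : ℕ, 1 ≤ (F k).height M ∧
      (k + 2) * (F k).height M < (F (k + 1)).height M ∧
      |((F k).b₁ : ℝ) * ξ.1 + (F k).b₂ * ξ.2 + (F k).b₃| <
        (c + 1 / (k + 1)) / (F (k + 1)).height M ^ n ∧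
      ∀ a₁ a₂ a₃ : ℤ, (a₁ ≠ 0 ∨ a₂ ≠ 0) → M (a₁, a₂) < (F (k + 1)).height M →
        c / (F (k + 1)).height M ^ n < |(a₁ : ℝ) * ξ.1 + a₂ * ξ.2 + a₃| := by
  have hstep : ∀ (k : ℕ) (P : RatFlag × {δ : ℝ // 0 < δ}), ∃ P' : RatFlag × {δ : ℝ // 0 < δ},
      (k + 2) * P.1.height M < P'.1.height M ∧ 1 ≤ P'.1.height M ∧
      Metric.closedBall P'.1.pt P'.2 ⊆ Metric.closedBall P.1.pt P.2 ∧
      ∀ ξ ∈ Metric.closedBall P'.1.pt P'.2,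
        |(P.1.b₁ : ℝ) * ξ.1 + P.1.b₂ * ξ.2 + P.1.b₃| < (c + 1 / (k + 1)) / P'.1.height M ^ n ∧
        ∀ a₁ a₂ a₃ : ℤ, (a₁ ≠ 0 ∨ a₂ ≠ 0) → M (a₁, a₂) < P'.1.height M →
          c / P'.1.height M ^ n < |(a₁ : ℝ) * ξ.1 + a₂ * ξ.2 + a₃| := by
    intro k P
    obtain ⟨F', δ', hδ', h1, h2, h3, h4⟩ := P.1.exists_step_closedBall hC0 hC hn hc
      ((k + 2) * P.1.height M) P.2.2 (ε := 1 / (k + 1)) (by positivity)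
    exact ⟨(F', ⟨δ', hδ'⟩), h1, h2, h3, h4⟩
  choose f hf using hstep
  let F₀ : RatFlag :=
    { b₁ := 1, b₂ := 0, b₃ := 0, p₁ := 0, p₂ := 0
      ne_zero := by simp
      mem_line := by simp
      primitive := fun a₁ a₂ a₃ h1 _ _ => ⟨a₁, by simp, by simpa using h1.symm⟩ }
  let P : ℕ → RatFlag × {δ : ℝ // 0 < δ} := fun k => Nat.rec (F₀, ⟨1, one_pos⟩) f k
  have hP : ∀ k, P (k + 1) = f k (P k) := fun k => rfl
  obtain ⟨ξ, hξ⟩ := IsCompact.nonempty_iInter_of_sequence_nonempty_isCompact_isClosed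
    (fun k => Metric.closedBall (P k).1.pt (P k).2) (fun k => by
      rw [hP]
      exact (hf k (P k)).2.2.1) (fun k => Metric.nonempty_closedBall.2 (P k).2.2.le)
    (isCompact_closedBall _ _) (fun k => Metric.isClosed_closedBall)
  rw [Set.mem_iInter] at hξ
  refine ⟨ξ, fun k => (P (k + 1)).1, fun k => ?_⟩
  have h0 := hf k (P k)
  have h1 := hf (k + 1) (P (k + 1))
  have h2 := h1.2.2.2 ξ (hξ (k + 2))
  rw [← hP] at h0
  rw [← hP] at h1
  have hX1 : 0 < (P (k + 1)).1.height M := by linarith [h0.2.1]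
  have hX2 : 0 < (P (k + 1 + 1)).1.height M := by linarith [h1.2.1]
  refine ⟨h0.2.1, lt_trans ?_ h1.1, h2.1.trans_le ?_, h2.2⟩
  · gcongr
    simp
  · rw [← hP]
    gcongr
    simp

end Step

/-! ### Norms on a finite-dimensional space -/

theorem exists_seminorm_le_norm {n : ℕ} (N : Seminorm ℝ (Fin n → ℝ)) :
    ∃ D : ℝ, 0 < D ∧ ∀ x, N x ≤ D * ‖x‖ := by
  refine ⟨∑ i, N (Pi.single i 1) + 1, by positivity, fun x => ?_⟩
  calc N x = N (∑ i, x i • (Pi.single i 1 : Fin n → ℝ)) := by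
        congr 1
        exact pi_eq_sum_univ' x
    _ ≤ ∑ i, N (x i • (Pi.single i 1 : Fin n → ℝ)) :=
        Finset.le_sum_of_subadditive N (map_zero N).le (map_add_le_add N) _ _
    _ ≤ ∑ i, ‖x‖ * N (Pi.single i 1) := by
        gcongr with i
        rw [map_smul_eq_mul]
        gcongr
        exact norm_le_pi_norm x i
    _ ≤ _ := by
        rw [← Finset.mul_sum]
        nlinarith [norm_nonneg x]

theorem exists_norm_le_seminorm {n : ℕ} (N : Seminorm ℝ (Fin n → ℝ))
    (hN : ∀ x : Fin n → ℝ, N x = 0 → x = 0) : ∃ C : ℝ, 0 < C ∧ ∀ x, ‖x‖ ≤ C * N x := by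
  obtain ⟨D, hD, hle⟩ := exists_seminorm_le_norm N
  have hcont : Continuous N := by
    refine Seminorm.continuous_of_le (q := D.toNNReal • normSeminorm ℝ (Fin n → ℝ))
      ?_ fun x => ?_
    · exact (continuous_const.mul continuous_norm : Continuous fun x : Fin n → ℝ =>
        (D.toNNReal : ℝ) * ‖x‖)
    · change N x ≤ (D.toNNReal : ℝ) * ‖x‖
      rw [Real.coe_toNNReal _ hD.le]
      exact hle x
  rcases (Metric.sphere (0 : Fin n → ℝ) 1).eq_empty_or_nonempty with hS | hS
  · refine ⟨1, one_pos, fun x => ?_⟩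
    by_cases hx : x = 0
    · simp [hx]
    · have : ‖x‖⁻¹ • x ∈ Metric.sphere (0 : Fin n → ℝ) 1 := by
        simp [norm_smul, norm_ne_zero_iff.2 hx]
      simp [hS] at this
  · obtain ⟨u, hu, hmin⟩ := (isCompact_sphere (0 : Fin n → ℝ) 1).exists_isMinOn hS
      hcont.continuousOn
    have hu0 : 0 < N u := by
      refine lt_of_le_of_ne (apply_nonneg _ _) fun h => ?_
      have := hN u h.symm
      simp [this] at hu
    refine ⟨(N u)⁻¹, by positivity, fun x => ?_⟩
    by_cases hx : x = 0
    · simp [hx]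
    · have hx' : 0 < ‖x‖ := norm_pos_iff.2 hx
      have h1 : N u ≤ N (‖x‖⁻¹ • x) := hmin (by simp [norm_smul, hx'.ne'])
      rw [map_smul_eq_mul, norm_inv, norm_norm, inv_mul_eq_div, le_div_iff₀ hx'] at h1
      rwa [inv_mul_eq_div, le_div_iff₀ hu0, mul_comm]

/-- The number of integer points in a ball, in terms of a comparison constant with the maximum
norm. -/
theorem exists_finset_lattice_points {n : ℕ} {N : Seminorm ℝ (Fin n → ℝ)} {C : ℝ} (hC0 : 0 < C)
    (hC : ∀ x, ‖x‖ ≤ C * N x) {X : ℝ} (hX : 1 ≤ X) :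
    ∃ S : Finset (Fin n → ℤ), (∀ b : Fin n → ℤ, N (fun i => (b i : ℝ)) < X → b ∈ S) ∧
      (S.card : ℝ) ≤ (2 * C + 1) ^ n * X ^ n := by
  refine ⟨Fintype.piFinset fun _ => Finset.Icc (-⌊C * X⌋) ⌊C * X⌋, fun b hb => ?_, ?_⟩
  · rw [Fintype.mem_piFinset]
    intro i
    have h1 : |(b i : ℝ)| ≤ C * X :=
      (norm_le_pi_norm (fun i => (b i : ℝ)) i).trans ((hC _).trans (by gcongr))
    have h2 : |b i| ≤ ⌊C * X⌋ := by
      rw [Int.le_floor]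
      exact_mod_cast h1
    rw [Finset.mem_Icc]
    exact abs_le.1 h2
  · have h0 : 0 ≤ ⌊C * X⌋ := Int.floor_nonneg.2 (by positivity)
    rw [Fintype.card_piFinset_const, Int.card_Icc, ← mul_pow]
    push_cast
    gcongr
    have h1 : (((⌊C * X⌋ + 1 - -⌊C * X⌋).toNat : ℤ) : ℝ) = 2 * ⌊C * X⌋ + 1 := by
      rw [Int.toNat_of_nonneg (by omega)]
      push_cast
      ring
    rw [Int.cast_natCast] at h1
    rw [h1]
    have := Int.floor_le (C * X)
    linarith

/-! ### Small values of integral linear forms on the unit cube -/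

/-- The set of points of the unit cube where an inhomogeneous integral linear form is within `κ` of
an integer has measure at most `2 κ`: modulo one, the form is the translate of a surjective
homomorphism from the torus to the circle, which preserves the Haar measure. -/
theorem volume_near_integer_le {m : ℕ} (β : Fin m → ℤ) (hβ : ∃ i, β i ≠ 0) (r κ : ℝ) :
    volume {η : Fin m → ℝ | η ∈ Set.univ.pi (fun _ => Set.Ioc (0 : ℝ) 1) ∧
      ∃ b' : ℤ, |(∑ i, (β i : ℝ) * η i) + r + b'| ≤ κ} ≤ ENNReal.ofReal (2 * κ) := by
  let φ : (Fin m → UnitAddCircle) →+ UnitAddCircle :=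
    { toFun := fun z => ∑ i, β i • z i
      map_zero' := by simp
      map_add' := fun x y => by simp [Finset.sum_add_distrib] }
  have hφc : Continuous φ := by
    change Continuous fun z : Fin m → UnitAddCircle => ∑ i, β i • z i
    fun_prop
  have hφs : Function.Surjective φ := by
    intro y
    obtain ⟨i, hi⟩ := hβ
    obtain ⟨x, rfl⟩ := QuotientAddGroup.mk_surjective y
    refine ⟨Pi.single i ((x / β i : ℝ) : UnitAddCircle), ?_⟩
    change ∑ j, β j • (Pi.single i ((x / β i : ℝ) : UnitAddCircle) : Fin m → UnitAddCircle) j = _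
    rw [Finset.sum_eq_single i (fun j _ hj => by simp [hj]) (by simp), Pi.single_eq_same,
      ← AddCircle.coe_zsmul, zsmul_eq_mul, mul_div_cancel₀ _ (by exact_mod_cast hi)]
  have hφ : MeasurePreserving φ volume volume :=
    AddMonoidHom.measurePreserving hφc hφs (by simp [volume_pi, Measure.pi_univ])
  have hmk : MeasurePreserving (fun (η : Fin m → ℝ) i => (η i : UnitAddCircle))
      (volume.restrict (Set.univ.pi fun _ => Set.Ioc (0 : ℝ) 1)) volume := by
    have h := measurePreserving_pi (fun _ : Fin m => volume.restrict (Set.Ioc (0 : ℝ) 1))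
      (fun _ => (volume : Measure UnitAddCircle))
      (f := fun _ => ((↑) : ℝ → UnitAddCircle)) (fun _ => by
        simpa using UnitAddCircle.measurePreserving_mk 0)
    rwa [← Measure.restrict_pi_pi] at h
  have hF := (measurePreserving_add_right (volume : Measure UnitAddCircle)
    (r : UnitAddCircle)).comp (hφ.comp hmk)
  have hmeas : MeasurableSet (Metric.closedBall (0 : UnitAddCircle) κ) :=
    Metric.isClosed_closedBall.measurableSet
  have hvol := hF.measure_preimage hmeas.nullMeasurableSet
  rw [Measure.restrict_apply (hF.measurable hmeas), AddCircle.volume_closedBall] at hvol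
  calc _ ≤ _ := measure_mono ?_
    _ = _ := hvol
    _ ≤ _ := ENNReal.ofReal_le_ofReal (min_le_right _ _)
  rintro η ⟨hη, b', hb'⟩
  refine ⟨?_, hη⟩
  rw [Set.mem_preimage, mem_closedBall_zero_iff]
  have hval : ((fun x => x + (r : UnitAddCircle)) ∘ φ ∘ fun (η : Fin m → ℝ) i =>
      (η i : UnitAddCircle)) η = (((∑ i, (β i : ℝ) * η i) + r + b' : ℝ) : UnitAddCircle) := by
    change ∑ i, β i • (η i : UnitAddCircle) + (r : UnitAddCircle) = _
    have hb0 : ((b' : ℝ) : UnitAddCircle) = 0 := by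
      rw [AddCircle.coe_eq_zero_iff]
      exact ⟨b', by simp⟩
    rw [AddCircle.coe_add, AddCircle.coe_add, hb0, add_zero]
    congr 1
    refine Eq.trans ?_ (map_sum (QuotientAddGroup.mk' (AddSubgroup.zmultiples (1 : ℝ))) _ _).symm
    refine Finset.sum_congr rfl fun i _ => ?_
    rw [← AddCircle.coe_zsmul, zsmul_eq_mul]
    rfl
  rw [hval]
  exact (QuotientAddGroup.norm_mk_le_norm).trans hb'

/-! ### Reading off the asymptotic constants -/

theorem psi_le {n : ℕ} (N : Seminorm ℝ (Fin n → ℝ)) (ξ : Fin n → ℝ) {t : ℝ} (b : Fin n → ℤ)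
    (b' : ℤ) (h1 : 1 ≤ N (fun i => (b i : ℝ))) (ht : N (fun i => (b i : ℝ)) ≤ t) :
    psi N ξ t ≤ |(∑ i, (b i : ℝ) * ξ i) + b'| :=
  csInf_le ⟨0, by rintro y ⟨_, _, _, _, rfl⟩; exact abs_nonneg _⟩ ⟨b, b', h1, ht, rfl⟩

section Criterion

variable {n : ℕ} {N : Seminorm ℝ (Fin n → ℝ)} {ξ : Fin n → ℝ} {c : ℝ} {b : ℕ → Fin n → ℤ}
  {b' : ℕ → ℤ} {X : ℕ → ℝ}

theorem natCast_add_one_le_of_growth (hX1 : ∀ k, 1 ≤ X k)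
    (hgrow : ∀ k : ℕ, (k + 2) * X k < X (k + 1)) (k : ℕ) : (k : ℝ) + 1 ≤ X k := by
  cases k with
  | zero => simpa using hX1 0
  | succ k =>
    have h1 := hgrow k
    have h2 := hX1 k
    push_cast
    nlinarith [(Nat.cast_nonneg k : (0 : ℝ) ≤ k)]

/-- If `b k` has height `X k` and is almost as small as `c / X (k + 1) ^ n`, then it bounds
`psi` on all of `[X k, X (k + 1))`. -/
theorem Theta_le (hX : ∀ k, N (fun i => (b k i : ℝ)) = X k) (hX1 : ∀ k, 1 ≤ X k)
    (hgrow : ∀ k : ℕ, (k + 2) * X k < X (k + 1))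
    (hup : ∀ k : ℕ, |(∑ i, (b k i : ℝ) * ξ i) + b' k| < (c + 1 / (k + 1)) / X (k + 1) ^ n) :
    Theta N ξ ≤ (c : EReal) := by
  have hXk := natCast_add_one_le_of_growth hX1 hgrow
  have hmono : StrictMono X := strictMono_nat_of_lt_succ fun k => by
    have := hgrow k
    have := hX1 k
    nlinarith [(Nat.cast_nonneg k : (0 : ℝ) ≤ k)]
  refine le_of_forall_gt fun a ha => ?_
  obtain ⟨e, he1, he2⟩ := EReal.lt_iff_exists_real_btwn.1 ha
  rw [EReal.coe_lt_coe_iff] at he1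
  obtain ⟨K, hK⟩ := exists_nat_one_div_lt (sub_pos.2 he1)
  refine lt_of_le_of_lt (limsup_le_of_le (h := ?_)) he2
  filter_upwards [eventually_ge_atTop (X K)] with t ht
  rw [EReal.coe_le_coe_iff]
  have hex : ∃ j, t < X j := by
    obtain ⟨j, hj⟩ := exists_nat_gt t
    exact ⟨j, by linarith [hXk j]⟩
  have hspec := Nat.find_spec hex
  have hmin := fun j => @Nat.find_min _ _ hex j
  obtain ⟨k, hk⟩ : ∃ k, Nat.find hex = k + 1 := by
    refine Nat.exists_eq_succ_of_ne_zero fun h0 => ?_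
    rw [h0] at hspec
    exact absurd (ht.trans_lt hspec) (not_lt.2 (hmono.monotone (Nat.zero_le K)))
  rw [hk] at hspec
  have hkt : X k ≤ t := not_lt.1 (hmin k (by omega))
  have hKk : K ≤ k := by
    by_contra! h
    exact absurd (ht.trans_lt hspec) (not_lt.2 (hmono.monotone h))
  have ht0 : 0 ≤ t := by linarith [hX1 k]
  have hXp : 0 < X (k + 1) := by linarith [hX1 (k + 1)]
  have hB : |(∑ i, (b k i : ℝ) * ξ i) + b' k| * X (k + 1) ^ n ≤ c + 1 / (k + 1) :=
    ((lt_div_iff₀ (by positivity)).1 (hup k)).le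
  have h3 : (1 : ℝ) / (k + 1) ≤ 1 / (K + 1) := by gcongr
  calc t ^ n * psi N ξ t ≤ t ^ n * |(∑ i, (b k i : ℝ) * ξ i) + b' k| := by
        gcongr
        exact psi_le N ξ (b k) (b' k) ((hX k).symm ▸ hX1 k) ((hX k).symm ▸ hkt)
    _ ≤ X (k + 1) ^ n * |(∑ i, (b k i : ℝ) * ξ i) + b' k| := by gcongr
    _ ≤ e := by linarith

/-- If infinitely often no integral form of height less than `X (k + 1)` is smaller than
`c / X (k + 1) ^ n`, then `psi` is large just below these heights. The forms `b k` serve only to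
make the set defining `psi` nonempty there. -/
theorem le_Theta (hX : ∀ k, N (fun i => (b k i : ℝ)) = X k) (hX1 : ∀ k, 1 ≤ X k)
    (hgrow : ∀ k : ℕ, (k + 2) * X k < X (k + 1))
    (hlow : ∃ᶠ k in atTop, ∀ (a : Fin n → ℤ) (a' : ℤ), a ≠ 0 → N (fun i => (a i : ℝ)) < X (k + 1) →
      c / X (k + 1) ^ n < |(∑ i, (a i : ℝ) * ξ i) + a'|) :
    (c : EReal) ≤ Theta N ξ := by
  have hXk := natCast_add_one_le_of_growth hX1 hgrow
  refine le_of_forall_lt fun a ha => ?_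
  obtain ⟨e, he1, he2⟩ := EReal.lt_iff_exists_real_btwn.1 ha
  rw [EReal.coe_lt_coe_iff] at he2
  obtain ⟨r, hre, hr1, hr2⟩ : ∃ r : ℝ, e < r ^ n * c ∧ 1 / 2 < r ∧ r < 1 := by
    have hcont : Continuous fun r : ℝ => r ^ n * c := by fun_prop
    have h1 : ∀ᶠ r in 𝓝[<] (1 : ℝ), e < r ^ n * c :=
      (hcont.continuousAt.eventually_const_lt (by simpa using he2)).filter_mono nhdsWithin_le_nhds
    have h2 : ∀ᶠ r in 𝓝[<] (1 : ℝ), 1 / 2 < r ∧ r < 1 :=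
      Ioo_mem_nhdsLT (by norm_num)
    exact (h1.and h2).exists
  refine lt_of_lt_of_le he1 (le_limsup_of_frequently_le' ?_)
  rw [frequently_atTop]
  intro T
  obtain ⟨K, hK⟩ := exists_nat_gt (2 * T)
  obtain ⟨k, hkK, hk⟩ := (frequently_atTop.1 hlow) K
  have hkR : (K : ℝ) ≤ k := by exact_mod_cast hkK
  have hXp : 0 < X (k + 1) := by linarith [hX1 (k + 1)]
  have hX2 := hXk (k + 1)
  push_cast at hX2
  refine ⟨r * X (k + 1), by nlinarith, ?_⟩
  rw [EReal.coe_le_coe_iff]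
  have hpsi : c / X (k + 1) ^ n ≤ psi N ξ (r * X (k + 1)) := by
    refine le_csInf ⟨_, b k, 0, (hX k).symm ▸ hX1 k, ?_, rfl⟩ ?_
    · rw [hX]
      have := hgrow k
      have := hX1 k
      nlinarith [(Nat.cast_nonneg k : (0 : ℝ) ≤ k)]
    · rintro y ⟨a, a', ha1, ha2, rfl⟩
      refine (hk a a' ?_ (by nlinarith)).le
      rintro rfl
      have h0 : N (fun _ => 0) = 0 := map_zero N
      simp [h0] at ha1
      linarith
  calc e ≤ r ^ n * c := hre.le
    _ = (r * X (k + 1)) ^ n * (c / X (k + 1) ^ n) := by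
      rw [mul_pow]
      field_simp
    _ ≤ _ := by gcongr

/-- Along the heights of the forms `b k` the scaled minimum tends to zero, since the ratios
`X (k + 1) / X k` are unbounded. -/
theorem notMem_Bad (hn : n ≠ 0) (hN : ∀ x : Fin n → ℝ, N x = 0 → x = 0)
    (hX : ∀ k, N (fun i => (b k i : ℝ)) = X k) (hX1 : ∀ k, 1 ≤ X k)
    (hgrow : ∀ k : ℕ, (k + 2) * X k < X (k + 1))
    (hup : ∀ k : ℕ, |(∑ i, (b k i : ℝ) * ξ i) + b' k| < (c + 1 / (k + 1)) / X (k + 1) ^ n) :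
    ξ ∉ Bad n := by
  have hXk := natCast_add_one_le_of_growth hX1 hgrow
  obtain ⟨C, hC0, hC⟩ := exists_norm_le_seminorm N hN
  obtain ⟨D, hD0, hD⟩ := exists_seminorm_le_norm N
  intro hbad
  change 0 < ThetaTilde _ _ at hbad
  obtain ⟨e, he1, he2⟩ := EReal.lt_iff_exists_real_btwn.1 hbad
  rw [EReal.coe_pos] at he1
  obtain ⟨T, hT⟩ := eventually_atTop.1 (eventually_lt_of_lt_liminf he2)
  obtain ⟨k, hk⟩ := exists_nat_gt (max (D * T) (C ^ n * (c + 1) / e))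
  rw [max_lt_iff, div_lt_iff₀ he1] at hk
  set Y : ℝ := ‖(fun i => (b k i : ℝ))‖ with hY
  have hXY : X k ≤ D * Y := hX k ▸ hD _
  have hYX : Y ≤ C * X k := hX k ▸ hC _
  have hTY : T ≤ Y := by
    have := hXk k
    refine le_of_mul_le_mul_left ?_ hD0
    linarith
  have hY1 : 1 ≤ Y := by
    obtain ⟨i, hi⟩ : ∃ i, b k i ≠ 0 := by
      by_contra! h
      have h1 := hX k
      have h0 : N (fun _ => 0) = 0 := map_zero N
      simp only [h, Int.cast_zero, h0] at h1
      linarith [hX1 k]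
    have h1 : (1 : ℝ) ≤ |(b k i : ℝ)| := by exact_mod_cast Int.one_le_abs hi
    exact h1.trans (norm_le_pi_norm (fun i => (b k i : ℝ)) i)
  have h1 := EReal.coe_lt_coe_iff.1 (hT Y hTY)
  have h2 := psi_le (normSeminorm ℝ (Fin n → ℝ)) ξ (b k) (b' k) hY1 le_rfl
  have hXp : 0 < X (k + 1) := by linarith [hX1 (k + 1)]
  have hX0 : 0 < X k := by linarith [hX1 k]
  have hB : |(∑ i, (b k i : ℝ) * ξ i) + b' k| * X (k + 1) ^ n ≤ c + 1 / (k + 1) :=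
    ((lt_div_iff₀ (by positivity)).1 (hup k)).le
  have h3 : (1 : ℝ) / (k + 1) ≤ 1 := by
    rw [div_le_one (by positivity)]
    linarith [(Nat.cast_nonneg k : (0 : ℝ) ≤ k)]
  have h4 : (k : ℝ) * X k ^ n ≤ X (k + 1) ^ n := by
    calc (k : ℝ) * X k ^ n ≤ (k + 2) ^ n * X k ^ n := by
          gcongr
          have : (k : ℝ) + 2 ≤ (k + 2) ^ n :=
            le_self_pow₀ (by linarith [(Nat.cast_nonneg k : (0 : ℝ) ≤ k)]) hn
          linarith
      _ = ((k + 2) * X k) ^ n := (mul_pow _ _ _).symm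
      _ ≤ _ := by
        gcongr
        exact (hgrow k).le
  set B := |(∑ i, (b k i : ℝ) * ξ i) + b' k|
  have h5 : e ≤ (C * X k) ^ n * B := by
    calc e ≤ Y ^ n * psi (normSeminorm ℝ (Fin n → ℝ)) ξ Y := h1.le
      _ ≤ Y ^ n * B := by
        gcongr
        exact h2
      _ ≤ _ := by gcongr
  have h6 : k * e ≤ C ^ n * (c + 1) := by
    calc k * e ≤ k * ((C * X k) ^ n * B) := by gcongr
      _ = C ^ n * ((k * X k ^ n) * B) := by rw [mul_pow]; ring
      _ ≤ C ^ n * (X (k + 1) ^ n * B) := by gcongr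
      _ ≤ _ := by
        gcongr
        linarith
  linarith [hk.2]

end Criterion

/-! ### Adding generic coordinates to a point of the plane -/

/-- The point of `ℝ^(m+2)` whose first two coordinates are `z` and whose remaining ones are `η`. -/
def extend {m : ℕ} (z : ℝ × ℝ) (η : Fin m → ℝ) : Fin (m + 2) → ℝ :=
  Fin.cons z.1 (Fin.cons z.2 η)

theorem sum_mul_extend {m : ℕ} (b : Fin (m + 2) → ℤ) (z : ℝ × ℝ) (η : Fin m → ℝ) :
    ∑ i, (b i : ℝ) * extend z η i =
      b 0 * z.1 + b 1 * z.2 + ∑ i : Fin m, (b i.succ.succ : ℝ) * η i := by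
  rw [Fin.sum_univ_succ, Fin.sum_univ_succ]
  exact (add_assoc _ _ _).symm

/-- The inclusion of the plane as the span of the first two coordinate vectors. -/
def planeInclusion (m : ℕ) : ℝ × ℝ →ₗ[ℝ] (Fin (m + 2) → ℝ) where
  toFun z := extend z 0
  map_add' x y := by
    ext i
    refine Fin.cases rfl (fun i => Fin.cases rfl (fun i => ?_) i) i
    simp [extend]
  map_smul' r x := by
    ext i
    refine Fin.cases rfl (fun i => Fin.cases rfl (fun i => ?_) i) i
    simp [extend]

theorem intCast_eq_planeInclusion {m : ℕ} {b : Fin (m + 2) → ℤ}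
    (hb : ∀ i : Fin m, b i.succ.succ = 0) :
    (fun i => (b i : ℝ)) = planeInclusion m (b 0, b 1) := by
  ext i
  refine Fin.cases rfl (fun i => Fin.cases rfl (fun i => ?_) i) i
  simp [planeInclusion, extend, hb]

/-- Outside a set of measure at most `2 c (2 C + 1) ^ (m + 2)` of the unit cube, no integral form
that involves the generic coordinates and has height less than `X` is as small as
`c / X ^ (m + 2)`. -/
theorem volume_small_form_le {m : ℕ} {N : Seminorm ℝ (Fin (m + 2) → ℝ)} {C : ℝ} (hC0 : 0 < C)
    (hC : ∀ x, ‖x‖ ≤ C * N x) {c : ℝ} (hc : 0 ≤ c) {X : ℝ} (hX : 1 ≤ X) (z : ℝ × ℝ) :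
    volume {η : Fin m → ℝ | η ∈ Set.univ.pi (fun _ => Set.Ioc (0 : ℝ) 1) ∧
      ∃ (a : Fin (m + 2) → ℤ) (a' : ℤ), (∃ i : Fin m, a i.succ.succ ≠ 0) ∧
        N (fun i => (a i : ℝ)) < X ∧ |(∑ i, (a i : ℝ) * extend z η i) + a'| ≤ c / X ^ (m + 2)} ≤
      ENNReal.ofReal (2 * c * (2 * C + 1) ^ (m + 2)) := by
  classical
  obtain ⟨S, hS, hcard⟩ := exists_finset_lattice_points hC0 hC hX
  let κ := c / X ^ (m + 2)
  have hXp : 0 < X ^ (m + 2) := by positivity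
  let S' := S.filter fun a => ∃ i : Fin m, a i.succ.succ ≠ 0
  let A : (Fin (m + 2) → ℤ) → Set (Fin m → ℝ) := fun a =>
    {η | η ∈ Set.univ.pi (fun _ => Set.Ioc (0 : ℝ) 1) ∧
      ∃ a' : ℤ, |(∑ i : Fin m, (a i.succ.succ : ℝ) * η i) + (a 0 * z.1 + a 1 * z.2) + a'| ≤ κ}
  have hA : ∀ a ∈ S', volume (A a) ≤ ENNReal.ofReal (2 * κ) := fun a ha =>
    volume_near_integer_le (fun i => a i.succ.succ) (Finset.mem_filter.1 ha).2 _ _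
  calc _ ≤ volume (⋃ a ∈ S', A a) := by
        refine measure_mono ?_
        rintro η ⟨hη, a, a', ha, hlt, hle⟩
        refine Set.mem_biUnion (Finset.mem_filter.2 ⟨hS a hlt, ha⟩) ⟨hη, a', ?_⟩
        rw [sum_mul_extend, add_comm (_ + _ : ℝ) (∑ i, _)] at hle
        exact hle
    _ ≤ ∑ a ∈ S', volume (A a) := measure_biUnion_finset_le _ _
    _ ≤ ∑ a ∈ S', ENNReal.ofReal (2 * κ) := Finset.sum_le_sum hA
    _ ≤ ∑ a ∈ S, ENNReal.ofReal (2 * κ) :=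
        Finset.sum_le_sum_of_subset (Finset.filter_subset _ _)
    _ = ENNReal.ofReal (S.card * (2 * κ)) := by
        rw [Finset.sum_const, nsmul_eq_mul, ENNReal.ofReal_mul (Nat.cast_nonneg _),
          ENNReal.ofReal_natCast]
    _ ≤ _ := by
        refine ENNReal.ofReal_le_ofReal ?_
        calc (S.card : ℝ) * (2 * κ) ≤ ((2 * C + 1) ^ (m + 2) * X ^ (m + 2)) * (2 * κ) := by
              gcongr
          _ = _ := by
            simp only [κ]
            field_simp

/-- If each of the sets `E k` covers at most half of the unit cube, then the points of the cube
that infinitely often avoid them form a set of full Hausdorff dimension, having positive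
measure. -/
theorem le_dimH_frequently_notMem {m : ℕ} {E : ℕ → Set (Fin m → ℝ)}
    (hE : ∀ k, volume (E k) ≤ ENNReal.ofReal (1 / 2)) :
    (m : ℝ≥0∞) ≤ dimH {η : Fin m → ℝ | η ∈ Set.univ.pi (fun _ => Set.Ioc (0 : ℝ) 1) ∧
      ∃ᶠ k in atTop, η ∉ E k} := by
  set Q : Set (Fin m → ℝ) := Set.univ.pi fun _ => Set.Ioc (0 : ℝ) 1
  have hQ : volume Q = 1 := by simp [Q, Real.volume_pi_Ioc]
  have hU : volume (⋃ j, ⋂ k ≥ j, E k) ≤ ENNReal.ofReal (1 / 2) := by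
    rw [Monotone.measure_iUnion (fun i j hij =>
      Set.biInter_subset_biInter_left fun k (hk : k ≥ j) => hij.trans hk)]
    exact iSup_le fun j => (measure_mono (Set.biInter_subset_of_mem (le_refl j))).trans (hE j)
  have hpos : volume (Q \ ⋃ j, ⋂ k ≥ j, E k) ≠ 0 := by
    intro h0
    have h1 := le_measure_sdiff (μ := volume) (s₁ := Q) (s₂ := ⋃ j, ⋂ k ≥ j, E k)
    rw [h0, hQ, nonpos_iff_eq_zero, tsub_eq_zero_iff_le] at h1
    have h2 := h1.trans hU
    rw [ENNReal.one_le_ofReal] at h2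
    norm_num at h2
  have hdim : ((m : NNReal) : ℝ≥0∞) ≤ dimH (Q \ ⋃ j, ⋂ k ≥ j, E k) := by
    refine le_dimH_of_hausdorffMeasure_ne_zero ?_
    have := hausdorffMeasure_pi_real (ι := Fin m)
    rw [Fintype.card_fin] at this
    rwa [NNReal.coe_natCast, this]
  refine le_trans (by exact_mod_cast hdim) (dimH_mono ?_)
  rintro η ⟨hη, hη'⟩
  refine ⟨hη, frequently_atTop.2 fun j => ?_⟩
  by_contra! h
  exact hη' (Set.mem_iUnion.2 ⟨j, Set.mem_iInter₂.2 h⟩)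

/-- For small `c`, the fibre of `FS N c` over a suitable point of the plane has positive measure. -/
theorem le_dimH_FS {m : ℕ} (hm : 1 ≤ m) {N : Seminorm ℝ (Fin (m + 2) → ℝ)}
    (hN : ∀ x : Fin (m + 2) → ℝ, N x = 0 → x = 0) {C : ℝ} (hC0 : 0 < C)
    (hC : ∀ x, ‖x‖ ≤ C * N x) {c : ℝ} (hc : 0 ≤ c)
    (hcC : 2 * c * (2 * C + 1) ^ (m + 2) ≤ 1 / 2) : (m : ℝ≥0∞) ≤ dimH (FS N c) := by
  let M : Seminorm ℝ (ℝ × ℝ) := N.comp (planeInclusion m)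
  have hCM : ∀ x, ‖x‖ ≤ C * M x := fun x => by
    refine le_trans ?_ (hC (planeInclusion m x))
    exact max_le (norm_le_pi_norm (planeInclusion m x) 0) (norm_le_pi_norm (planeInclusion m x) 1)
  obtain ⟨z, F, hF⟩ := exists_planar_point hC0 hCM (show 3 ≤ m + 2 by omega) hc
  let X : ℕ → ℝ := fun k => (F k).height M
  have hX1 : ∀ k, 1 ≤ X k := fun k => (hF k).1
  have hgrow : ∀ k : ℕ, (k + 2) * X k < X (k + 1) := fun k => (hF k).2.1
  let b : ℕ → Fin (m + 2) → ℤ := fun k => Fin.cons (F k).b₁ (Fin.cons (F k).b₂ 0)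
  have hb0 : ∀ k (i : Fin m), b k i.succ.succ = 0 := fun k i => by simp [b]
  have hX : ∀ k, N (fun i => (b k i : ℝ)) = X k := fun k => by
    rw [intCast_eq_planeInclusion (hb0 k)]
    rfl
  have hup : ∀ (η : Fin m → ℝ) (k : ℕ), |(∑ i, (b k i : ℝ) * extend z η i) + (F k).b₃| <
      (c + 1 / (k + 1)) / X (k + 1) ^ (m + 2) := fun η k => by
    rw [sum_mul_extend]
    simp only [hb0, Int.cast_zero, zero_mul, Finset.sum_const_zero, add_zero]
    exact (hF k).2.2.1
  let E : ℕ → Set (Fin m → ℝ) := fun k =>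
    {η : Fin m → ℝ | η ∈ Set.univ.pi (fun _ => Set.Ioc (0 : ℝ) 1) ∧
      ∃ (a : Fin (m + 2) → ℤ) (a' : ℤ), (∃ i : Fin m, a i.succ.succ ≠ 0) ∧
        N (fun i => (a i : ℝ)) < X (k + 1) ∧
        |(∑ i, (a i : ℝ) * extend z η i) + a'| ≤ c / X (k + 1) ^ (m + 2)}
  have hE : ∀ k, volume (E k) ≤ ENNReal.ofReal (1 / 2) := fun k =>
    (volume_small_form_le hC0 hC hc (hX1 (k + 1)) z).trans (ENNReal.ofReal_le_ofReal hcC)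
  have hlip : LipschitzWith 1 fun (x : Fin (m + 2) → ℝ) (i : Fin m) => x i.succ.succ :=
    LipschitzWith.of_dist_le_mul fun x y => by
      rw [NNReal.coe_one, one_mul, dist_pi_le_iff dist_nonneg]
      exact fun i => dist_le_pi_dist x y _
  refine (le_dimH_frequently_notMem hE).trans ((dimH_mono ?_).trans (hlip.dimH_image_le (FS N c)))
  rintro η ⟨hη, hfreq⟩
  refine ⟨extend z η, ⟨?_, notMem_Bad (by omega) hN hX hX1 hgrow (hup η)⟩, rfl⟩
  refine le_antisymm (Theta_le hX hX1 hgrow (hup η))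
    (le_Theta hX hX1 hgrow (hfreq.mono fun k hk a a' ha hlt => ?_))
  by_cases htail : ∃ i : Fin m, a i.succ.succ ≠ 0
  · by_contra! hle
    exact hk ⟨hη, a, a', htail, hlt, hle⟩
  · push Not at htail
    rw [sum_mul_extend]
    simp only [htail, Int.cast_zero, zero_mul, Finset.sum_const_zero, add_zero]
    refine (hF k).2.2.2 (a 0) (a 1) a' ?_ ?_
    · by_contra! h
      refine ha (funext fun i => ?_)
      exact Fin.cases h.1 (fun i => Fin.cases h.2 htail i) i
    · rw [intCast_eq_planeInclusion htail] at hlt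
      exact hlt

end DualDirichlet

theorem theorem2p4 (n : ℕ) (hn : 4 ≤ n) (N : Seminorm ℝ (Fin n → ℝ))
    (hN : ∀ x : Fin n → ℝ, N x = 0 → x = 0) :
    (∃ c₀ : ℝ, 0 < c₀ ∧ ∀ c : ℝ, c ∈ Set.Icc 0 c₀ →
      ((n - 2 : ℕ) : ℝ≥0∞) ≤ dimH (DualDirichlet.FS N c)) ∧
    DualDirichlet.dirichletSpectrum N ∈ 𝓝[≥] (0 : ℝ) := by
  obtain ⟨m, rfl⟩ : ∃ m, n = m + 2 := ⟨n - 2, by omega⟩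
  obtain ⟨C, hC0, hC⟩ := DualDirichlet.exists_norm_le_seminorm N hN
  have hK : 0 < 4 * (2 * C + 1) ^ (m + 2) := by positivity
  have hdim : ∀ c : ℝ, c ∈ Set.Icc 0 (1 / (4 * (2 * C + 1) ^ (m + 2))) →
      (m : ℝ≥0∞) ≤ dimH (DualDirichlet.FS N c) := fun c hc => by
    refine DualDirichlet.le_dimH_FS (by omega) hN hC0 hC hc.1 ?_
    have := (le_div_iff₀ hK).1 hc.2
    linarith
  refine ⟨⟨_, one_div_pos.2 hK, fun c hc => by simpa using hdim c hc⟩, ?_⟩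
  refine Filter.mem_of_superset (Icc_mem_nhdsGE (one_div_pos.2 hK)) fun c hc => ?_
  -- A set of positive dimension is nonempty.
  obtain ⟨ξ, hξ⟩ : (DualDirichlet.FS N c).Nonempty := by
    rw [Set.nonempty_iff_ne_empty]
    intro h
    have := hdim c hc
    rw [h, dimH_empty, nonpos_iff_eq_zero, Nat.cast_eq_zero] at this
    omega
  exact ⟨ξ, hξ.1⟩
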